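/- Let $K\subset\mathbb{R}^2$ be a compact convex set with perimeter $2p$ (if $K$ has no interior points, so that it is a segment or a point, the perimeter is understood as twice its length), and let $\zeta\in[0,\pi)$. Let $K_\zeta$ be the set of all points $\mathbf{p}\in\mathbb{R}^2$ from which $K$ appears under an angle at least $\pi-\zeta$; precisely, $\mathbf{p}\notin K_\zeta$ if and only if there is a convex cone with apex $\mathbf{p}$ and opening angle $\pi-\zeta$ that contains $K$ in its interior. Call a set in $\mathbb{R}^2$ rectifiable if it is a union of at most countably many rectifiable curves, and let $|\cdot|$ denote length (one-dimensional Hausdorff measure, possibly $+\infty$). Let $B\subset\mathbb{R}^2$ be a rectifiable barrier for $K$, that is, a rectifiable set such that every line that intersects $K$ also intersects $B$. Then every rectifiable set $B'\subseteq B$ with $B'\cap K_\zeta=\emptyset$ satisfies $$|B| \;\ge\; p+|B'|\Big(1-\cos\tfrac{\zeta}{2}\Big),$$ where $\infty\cdot 0=0$. -/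

import Mathlib

open scoped MeasureTheory

/-- The Euclidean plane. -/
abbrev Plane : Type := EuclideanSpace ℝ (Fin 2)

/-- `B` is a barrier (opaque set) for `K`: every line that meets `K` meets `B`. -/
def IsBarrier (K B : Set Plane) : Prop :=
  ∀ L : AffineSubspace ℝ Plane, Module.finrank ℝ L.direction = 1 →
    ((L : Set Plane) ∩ K).Nonempty → ((L : Set Plane) ∩ B).Nonempty

/-- A rectifiable curve: the trace of a continuous path of finite length. -/
def IsRectifiableCurve (S : Set Plane) : Prop :=
  ∃ γ : ℝ → Plane, ContinuousOn γ (Set.Icc 0 1) ∧ BoundedVariationOn γ (Set.Icc 0 1) ∧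
    γ '' Set.Icc 0 1 = S

/-- A rectifiable set: a union of at most countably many rectifiable curves. -/
def IsRectifiable (B : Set Plane) : Prop :=
  ∃ C : Set (Set Plane), C.Countable ∧ (∀ S ∈ C, IsRectifiableCurve S) ∧ ⋃₀ C = B

/-- The length of a plane set: its one-dimensional Hausdorff measure, possibly infinite. -/
noncomputable def length (B : Set Plane) : ENNReal :=
  MeasureTheory.Measure.hausdorffMeasure 1 B

open Classical in
/-- The perimeter of a compact convex set: the length of its boundary, where a degenerate set
(without interior points, hence a segment, a point or empty) is counted as traversed twice. -/
noncomputable def perimeter (K : Set Plane) : ENNReal :=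
  if (interior K).Nonempty then length (frontier K) else 2 * length K

/-- The closed cone with apex `p`, unit axis vector `u` and opening angle `θ`: it consists of `p`
and of all points `x` for which the angle between `x - p` and `u` is at most `θ / 2`. -/
def cone (p u : Plane) (θ : ℝ) : Set Plane :=
  {x | ‖x - p‖ * Real.cos (θ / 2) ≤ inner ℝ u (x - p)}

/-- The set `K_ζ` of all points from which `K` appears under an angle at least `π - ζ`: a point `p`
is outside iff some cone with apex `p` and angle `π - ζ` contains `K` in its interior. -/
def viewSet (K : Set Plane) (ζ : ℝ) : Set Plane :=
  {p | ¬ ∃ u : Plane, ‖u‖ = 1 ∧ K ⊆ interior (cone p u (Real.pi - ζ))}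

/-! Project onto the direction `unitVec α` and integrate the length of the shadow over α in (0, π].
For `K` this integral is at least the perimeter 2p, the half of Cauchy's formula needed here
(`perimeter_le_lintegral_volume_image`). By the barrier property the shadow of `K` is covered by the
shadow of those points x of `B` for which the line through x with normal direction α meets `K`
(`IsBarrier.image_inner_subset`).

An element of length of `B` at x with tangent direction θ contributes at most the integral of |cos(α
- θ)| over these α (`lintegral_volume_image_inner_le`). Over all α that integral is 2. If x lies
outside K_ζ, then `K` is seen from x within an angle π - ζ, so modulo π the admissible α lie in an
interval of length π - ζ, and the integral is at most 2 cos(ζ/2) whatever θ is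
(`exists_forall_sin_le_of_notMem_viewSet`, `lintegral_abs_cos_sub_indicator_le`). Hence 2p ≤ 2
cos(ζ/2) |B'| + 2 |B \ B'|, which rearranges to the claim.

Two tools replace tangents and Cauchy's formula. Up to length zero, a rectifiable set is covered by
countably many pieces, each with one θ such that projection to direction α contracts it by at most
|cos(α - θ)| + ε (`IsRectifiable.hasFlatCover`). The perimeter of a convex body is bounded by side
lengths of circumscribed equiangular polygons, averaged over rotations (`length_frontier_le_sum`,
`length_frontier_le_integral`). -/

open Real Set MeasureTheory Filter Topology

/-! ### Unit vectors and coordinates in the plane -/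

/-- The unit vector of the plane at angle `α`. -/
noncomputable def unitVec (α : ℝ) : Plane := !₂[cos α, sin α]

theorem inner_unitVec (α : ℝ) (x : Plane) :
    inner ℝ (unitVec α) x = cos α * x 0 + sin α * x 1 := by
  simp [unitVec, PiLp.inner_apply, Fin.sum_univ_two, mul_comm]

theorem inner_unitVec_unitVec (α β : ℝ) :
    inner ℝ (unitVec α) (unitVec β) = cos (α - β) := by
  rw [inner_unitVec, cos_sub]; simp [unitVec]

theorem norm_unitVec (α : ℝ) : ‖unitVec α‖ = 1 := by
  have h := inner_unitVec_unitVec α α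
  rw [real_inner_self_eq_norm_sq, sub_self, cos_zero] at h
  exact (pow_eq_one_iff_of_nonneg (norm_nonneg _) two_ne_zero).1 h

theorem continuous_unitVec : Continuous unitVec := by
  unfold unitVec
  refine (PiLp.continuous_toLp 2 _).comp (continuous_pi fun i => ?_)
  fin_cases i
  · exact continuous_cos
  · exact continuous_sin

theorem abs_inner_unitVec_le (α : ℝ) (x : Plane) : |inner ℝ (unitVec α) x| ≤ ‖x‖ := by
  simpa [norm_unitVec] using abs_real_inner_le_norm (unitVec α) x

theorem exists_eq_norm_smul_unitVec (v : Plane) : ∃ θ, v = ‖v‖ • unitVec θ := by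
  set z : ℂ := ⟨v 0, v 1⟩
  have hz : ‖z‖ = ‖v‖ := by
    rw [EuclideanSpace.norm_eq, Complex.norm_def, Complex.normSq_apply, Fin.sum_univ_two]
    simp [z, sq]
  refine ⟨z.arg, ?_⟩
  ext i
  fin_cases i
  · have := (Complex.norm_mul_cos_arg z).symm
    rw [hz] at this
    exact this
  · have := (Complex.norm_mul_sin_arg z).symm
    rw [hz] at this
    exact this

theorem unitVec_add_pi (α : ℝ) : unitVec (α + π) = -unitVec α := by
  ext i; fin_cases i <;> simp [unitVec]

theorem unitVec_add_two_pi_int (α : ℝ) (m : ℤ) : unitVec (α + m * (2 * π)) = unitVec α := by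
  ext i; fin_cases i <;> simp [unitVec]

theorem eq_inner_smul_unitVec_add (α : ℝ) (x : Plane) :
    x = inner ℝ (unitVec α) x • unitVec α
      + inner ℝ (unitVec (α + π / 2)) x • unitVec (α + π / 2) := by
  have h := sin_sq_add_cos_sq α
  ext i
  fin_cases i
  · simp only [inner_unitVec]
    simp [unitVec, cos_add_pi_div_two, sin_add_pi_div_two]
    linear_combination -(x 0) * h
  · simp only [inner_unitVec]
    simp [unitVec, cos_add_pi_div_two, sin_add_pi_div_two]
    linear_combination -(x 1) * h

/-! ### Flat pieces and flat covers of rectifiable sets -/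

/-- `E` is contained in a Lipschitz graph almost parallel to `unitVec θ`. -/
def IsFlat (ε θ : ℝ) (E : Set Plane) : Prop :=
  ∀ x ∈ E, ∀ y ∈ E, ∀ α, |inner ℝ (unitVec α) (x - y)| ≤ (|cos (α - θ)| + ε) * ‖x - y‖

theorem IsFlat.mono {ε θ : ℝ} {E F : Set Plane} (h : IsFlat ε θ E) (hF : F ⊆ E) :
    IsFlat ε θ F := fun x hx y hy => h x (hF hx) y (hF hy)

theorem IsFlat.closure {ε θ : ℝ} {E : Set Plane} (h : IsFlat ε θ E) :
    IsFlat ε θ (_root_.closure E) := by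
  intro x hx y hy α
  have hc : IsClosed {p : Plane × Plane |
      |inner ℝ (unitVec α) (p.1 - p.2)| ≤ (|cos (α - θ)| + ε) * ‖p.1 - p.2‖} :=
    isClosed_le (by fun_prop) (by fun_prop)
  have : _root_.closure (E ×ˢ E) ⊆ {p : Plane × Plane |
      |inner ℝ (unitVec α) (p.1 - p.2)| ≤ (|cos (α - θ)| + ε) * ‖p.1 - p.2‖} :=
    closure_minimal (fun p hp => h p.1 hp.1 p.2 hp.2 α) hc
  exact this (show (x, y) ∈ _ by rw [closure_prod_eq]; exact ⟨hx, hy⟩)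

/-- The orthogonal projection of a flat set shrinks its length. -/
theorem IsFlat.volume_image_le {ε θ : ℝ} (hε : 0 ≤ ε) {E : Set Plane} (h : IsFlat ε θ E) (α : ℝ) :
    volume ((fun x => inner ℝ (unitVec α) x) '' E)
      ≤ ENNReal.ofReal (|cos (α - θ)| + ε) * length E := by
  have hl : LipschitzOnWith (Real.toNNReal (|cos (α - θ)| + ε))
      (fun x => inner ℝ (unitVec α) x : Plane → ℝ) E := by
    refine LipschitzOnWith.of_dist_le_mul fun x hx y hy => ?_
    rw [Real.dist_eq, ← inner_sub_right, dist_eq_norm, Real.coe_toNNReal _ (by positivity)]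
    exact h x hx y hy α
  have := hl.hausdorffMeasure_image_le (d := 1) zero_le_one
  simpa only [hausdorffMeasure_real, length, ENNReal.rpow_one, ENNReal.ofReal] using this

theorem volume_image_inner_le (α : ℝ) (E : Set Plane) :
    volume ((fun x => inner ℝ (unitVec α) x) '' E) ≤ length E := by
  have hl : LipschitzWith 1 (fun x => inner ℝ (unitVec α) x : Plane → ℝ) := by
    refine LipschitzWith.of_dist_le_mul fun x y => ?_
    rw [Real.dist_eq, ← inner_sub_right, dist_eq_norm]
    simpa using abs_inner_unitVec_le α (x - y)
  have := hl.hausdorffMeasure_image_le (d := 1) zero_le_one E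
  simpa [hausdorffMeasure_real, length] using this

/-- Increments of `f` differ from multiples of `A 1` by at most c|a - b|. This error enlarges the
projection and shortens the chord, and both effects fit into ε once c (1 + |cos| + ε) ≤ ε ‖A 1‖. As
ε ≤ 1, the bracket is at most 3, whence the constant ε / 3. -/
theorem isFlat_image_of_approximatesLinearOn {f : ℝ → Plane} {A : ℝ →L[ℝ] Plane} {s : Set ℝ}
    {c : NNReal} (h : ApproximatesLinearOn f A s c) {ε θ : ℝ} (hε : ε ≤ 1)
    (hc : (c : ℝ) ≤ ε / 3 * ‖A 1‖) (hθ : A 1 = ‖A 1‖ • unitVec θ) : IsFlat ε θ (f '' s) := by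
  rintro _ ⟨a, ha, rfl⟩ _ ⟨b, hb, rfl⟩ α
  have hab := h a ha b hb
  have hA : A (a - b) = ((a - b) * ‖A 1‖) • unitVec θ := by
    rw [mul_smul, ← hθ, ← map_smul]; simp
  set r := f a - f b - A (a - b) with hr
  have hd : f a - f b = A (a - b) + r := by rw [hr]; abel
  have h1 : |inner ℝ (unitVec α) (f a - f b)| ≤ |a - b| * ‖A 1‖ * |cos (α - θ)| + c * |a - b| := by
    rw [hd, inner_add_right, hA, inner_smul_right, inner_unitVec_unitVec]
    refine (abs_add_le _ _).trans (add_le_add ?_ ((abs_inner_unitVec_le _ _).trans ?_))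
    · simp [abs_mul]
    · simpa using hab
  have h2 : |a - b| * ‖A 1‖ - c * |a - b| ≤ ‖f a - f b‖ := by
    have h3 : ‖A (a - b)‖ = |a - b| * ‖A 1‖ := by
      rw [hA, norm_smul, norm_unitVec]; simp
    have h4 : ‖A (a - b)‖ ≤ ‖f a - f b‖ + ‖r‖ := by
      rw [show A (a - b) = (f a - f b) - r by rw [hd]; abel]; exact norm_sub_le _ _
    have h5 : ‖r‖ ≤ c * |a - b| := by simpa using hab
    linarith
  have hcos : |cos (α - θ)| ≤ 1 := abs_cos_le_one _
  have hcos0 := abs_nonneg (cos (α - θ))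
  rcases eq_or_ne (|a - b|) 0 with h0 | h0
  · have : a = b := by rwa [abs_eq_zero, sub_eq_zero] at h0
    subst this; simp
  have hε0 : 0 ≤ ε * ‖A 1‖ := by nlinarith [c.2, hc, show (0 : ℝ) ≤ c from c.2]
  rcases eq_or_ne (‖A 1‖) 0 with hv | hv
  · have hc0 : (c : ℝ) = 0 := le_antisymm (by simpa [hv] using hc) c.2
    have hi : |inner ℝ (unitVec α) (f a - f b)| ≤ 0 := by simpa [hv, hc0] using h1
    have hr0 : r = 0 := by
      have : ‖r‖ ≤ c * ‖a - b‖ := hab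
      simpa [hc0] using this
    have : f a - f b = 0 := by rw [hd, hr0, hA, hv]; simp
    simp [this]
  have hε1 : 0 ≤ ε := nonneg_of_mul_nonneg_left hε0 (lt_of_le_of_ne (norm_nonneg _) hv.symm)
  refine h1.trans (le_trans ?_ (mul_le_mul_of_nonneg_left h2 (by positivity)))
  have key : c * (1 + |cos (α - θ)| + ε) ≤ ε * ‖A 1‖ := by
    have : (c : ℝ) * (1 + |cos (α - θ)| + ε) ≤ c * 3 :=
      mul_le_mul_of_nonneg_left (by linarith) c.2
    linarith
  nlinarith [mul_le_mul_of_nonneg_left key (abs_nonneg (a - b))]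

/-- The critical values of a curve have length zero. -/
theorem length_image_eq_zero_of_hasFDerivWithinAt_zero {f : ℝ → Plane} {s : Set ℝ}
    (hs : volume s ≠ ⊤) (hf : ∀ x ∈ s, HasFDerivWithinAt f (0 : ℝ →L[ℝ] Plane) s x) :
    length (f '' s) = 0 := by
  rcases s.eq_empty_or_nonempty with rfl | hne
  · simp [length]
  -- On each piece of the partition `f` is ε-Lipschitz, since the approximating linear map is a
  -- derivative and so vanishes.
  have key : ∀ ε : NNReal, ε ≠ 0 → length (f '' s) ≤ ε * volume s := by
    intro ε hε
    obtain ⟨t, A, hd, hm, hst, happ, hA⟩ :=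
      exists_partition_approximatesLinearOn_of_hasFDerivWithinAt f s (fun _ => 0) hf
        (fun _ => ε) (fun _ => hε)
    have hl : ∀ n, length (f '' (s ∩ t n)) ≤ ε * volume (s ∩ t n) := by
      intro n
      have h1 : LipschitzOnWith ε f (s ∩ t n) := by
        obtain ⟨y, -, hy⟩ := hA hne n
        refine LipschitzOnWith.of_dist_le_mul fun x hx z hz => ?_
        have := happ n x hx z hz
        rw [hy] at this
        simpa [dist_eq_norm] using this
      have := h1.hausdorffMeasure_image_le (d := 1) zero_le_one
      simpa [hausdorffMeasure_real, length] using this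
    calc length (f '' s) ≤ length (⋃ n, f '' (s ∩ t n)) := by
          refine measure_mono ?_
          rw [← image_iUnion, ← inter_iUnion]
          exact image_mono (subset_inter subset_rfl hst)
      _ ≤ ∑' n, length (f '' (s ∩ t n)) := measure_iUnion_le _
      _ ≤ ∑' n, ε * volume (s ∩ t n) := ENNReal.tsum_le_tsum hl
      _ = ε * ∑' n, volume.restrict s (t n) := by
          rw [ENNReal.tsum_mul_left]
          simp_rw [Measure.restrict_apply (hm _), inter_comm]
      _ ≤ ε * volume s := by
          gcongr
          rw [← measure_iUnion hd hm]
          exact (measure_mono (subset_univ _)).trans (by simp)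
  by_contra hne0
  have hpos : volume s ≠ 0 := fun h =>
    hne0 (le_antisymm (by simpa [h] using key 1 one_ne_zero) bot_le)
  have hlt : length (f '' s) ≠ ⊤ :=
    ne_top_of_le_ne_top hs (by simpa using key 1 one_ne_zero)
  have h0 := ENNReal.div_pos hne0 hs
  obtain ⟨ε, hε0, hε⟩ := ENNReal.lt_iff_exists_nnreal_btwn.1 h0
  have h2 := key ε (by simpa using hε0.ne')
  rw [ENNReal.lt_div_iff_mul_lt (Or.inl hpos) (Or.inl hs)] at hε
  exact absurd hε h2.not_gt

theorem length_eq_zero_of_volume_eq_zero {C : NNReal} {f : ℝ → Plane} {s : Set ℝ}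
    (hf : LipschitzOnWith C f s) (hs : volume s = 0) : length (f '' s) = 0 := by
  have := hf.hausdorffMeasure_image_le (d := 1) zero_le_one
  simpa [hausdorffMeasure_real, length, hs] using this

/-- `B` is covered up to a set of length zero by countably many closed flat sets. -/
def HasFlatCover (ε : ℝ) (B : Set Plane) : Prop :=
  ∃ (E : ℕ → Set Plane) (θ : ℕ → ℝ), (∀ n, IsClosed (E n)) ∧ (∀ n, IsFlat ε (θ n) (E n)) ∧
    length (B \ ⋃ n, E n) = 0

theorem HasFlatCover.mono {ε : ℝ} {A B : Set Plane} (h : HasFlatCover ε B) (hA : A ⊆ B) :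
    HasFlatCover ε A := by
  obtain ⟨E, θ, h1, h2, h3⟩ := h
  exact ⟨E, θ, h1, h2, measure_mono_null (sdiff_subset_sdiff_left hA) h3⟩

/-- The domain splits into the points of non-differentiability (null by Rademacher), the critical
points (null image) and the rest. On the rest, `f` is close to linear maps with nonzero derivative
on countably many pieces, and these have flat images. -/
theorem hasFlatCover_image_of_lipschitzOnWith {C : NNReal} {f : ℝ → Plane} {s : Set ℝ}
    (hf : LipschitzOnWith C f s) (hs : volume s ≠ ⊤) {ε : ℝ} (hε : 0 < ε) (hε1 : ε ≤ 1) :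
    HasFlatCover ε (f '' s) := by
  classical
  set s₀ := {x ∈ s | ¬ DifferentiableWithinAt ℝ f s x} with hs₀
  have h0 : volume s₀ = 0 := by
    have := hf.ae_differentiableWithinAt_of_mem_real
    rw [ae_iff] at this
    simpa [hs₀] using this
  set f' : ℝ → ℝ →L[ℝ] Plane := fun x => fderivWithin ℝ f s x
  set s₁ := {x ∈ s | DifferentiableWithinAt ℝ f s x ∧ f' x = 0} with hs₁
  set s₂ := {x ∈ s | DifferentiableWithinAt ℝ f s x ∧ f' x ≠ 0} with hs₂
  have hunion : s ⊆ s₀ ∪ s₁ ∪ s₂ := by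
    intro x hx
    by_cases hd : DifferentiableWithinAt ℝ f s x
    · by_cases hz : f' x = 0
      · exact Or.inl (Or.inr ⟨hx, hd, hz⟩)
      · exact Or.inr ⟨hx, hd, hz⟩
    · exact Or.inl (Or.inl ⟨hx, hd⟩)
  have hl0 : length (f '' s₀) = 0 :=
    length_eq_zero_of_volume_eq_zero (hf.mono (sep_subset _ _)) h0
  have hl1 : length (f '' s₁) = 0 := by
    refine length_image_eq_zero_of_hasFDerivWithinAt_zero
      (ne_top_of_le_ne_top hs (measure_mono (sep_subset _ _))) fun x hx => ?_
    rw [← hx.2.2]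
    exact hx.2.1.hasFDerivWithinAt.mono (sep_subset _ _)
  rcases s₂.eq_empty_or_nonempty with h2e | hne
  · refine ⟨fun _ => ∅, fun _ => 0, fun _ => isClosed_empty, fun _ x hx => hx.elim, ?_⟩
    refine measure_mono_null ?_ (measure_union_null hl0 hl1)
    rw [← image_union]
    refine sdiff_subset.trans (image_mono ?_)
    simpa [h2e] using hunion
  obtain ⟨t, A, -, -, hst, happ, hA⟩ :=
    exists_partition_approximatesLinearOn_of_hasFDerivWithinAt f s₂ f'
      (fun x hx => hx.2.1.hasFDerivWithinAt.mono (sep_subset _ _))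
      -- The value 1 only keeps the tolerance nonzero; it is never used, because every `A n` is a
      -- derivative at a point of `s₂`.
      (fun A => if A 1 = 0 then 1 else Real.toNNReal (ε / 3 * ‖A 1‖))
      (fun A => by
        split_ifs with h
        · exact one_ne_zero
        · have := norm_pos_iff.2 h
          exact (Real.toNNReal_pos.2 (by positivity)).ne')
  choose θ hθ using fun n => exists_eq_norm_smul_unitVec (A n 1)
  have hA1 : ∀ n, A n 1 ≠ 0 := by
    intro n h
    obtain ⟨y, hy, hAy⟩ := hA hne n
    refine hy.2.2 ?_
    rw [← hAy]
    ext1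
    simpa using h
  refine ⟨fun n => closure (f '' (s₂ ∩ t n)), θ, fun n => isClosed_closure, fun n => ?_, ?_⟩
  · refine (isFlat_image_of_approximatesLinearOn (happ n) hε1 ?_ (hθ n)).closure
    rw [if_neg (hA1 n), Real.coe_toNNReal _ (by positivity)]
  · refine measure_mono_null ?_ (measure_union_null hl0 hl1)
    rintro _ ⟨⟨x, hx, rfl⟩, hn⟩
    rcases hunion hx with (h | h) | h
    · exact Or.inl ⟨x, h, rfl⟩
    · exact Or.inr ⟨x, h, rfl⟩
    · obtain ⟨n, hxn⟩ := mem_iUnion.1 (hst h)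
      exact (hn (mem_iUnion.2 ⟨n, subset_closure ⟨x, ⟨h, hxn⟩, rfl⟩⟩)).elim

/-- Parametrization by arc length turns finite variation into a 1-Lipschitz map on a bounded set of
parameters. -/
theorem IsRectifiableCurve.hasFlatCover {S : Set Plane} (hS : IsRectifiableCurve S) {ε : ℝ}
    (hε : 0 < ε) (hε1 : ε ≤ 1) : HasFlatCover ε S := by
  obtain ⟨γ, -, hv, rfl⟩ := hS
  have hlv := hv.locallyBoundedVariationOn
  have h0 : (0 : ℝ) ∈ Icc (0 : ℝ) 1 := by simp
  have h1 : (1 : ℝ) ∈ Icc (0 : ℝ) 1 := by simp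
  set φ := naturalParameterization γ (Icc 0 1) 0
  set τ := variationOnFromTo γ (Icc 0 1) 0
  have hφ : LipschitzOnWith 1 φ (τ '' Icc 0 1) := by
    have hu := has_unit_speed_naturalParameterization γ hlv h0
    intro x hx y hy
    rw [ENNReal.coe_one, one_mul]
    wlog hxy : x ≤ y generalizing x y
    · rw [edist_comm, edist_comm x]; exact this hy hx (le_of_not_ge hxy)
    have := hu hx hy
    refine (eVariationOn.edist_le φ (s := τ '' Icc 0 1 ∩ Icc x y) ⟨hx, left_mem_Icc.2 hxy⟩
      ⟨hy, right_mem_Icc.2 hxy⟩).trans ?_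
    rw [this, edist_comm, edist_dist, Real.dist_eq, abs_of_nonneg (sub_nonneg.2 hxy)]
    simp
  have hmono : MonotoneOn τ (Icc 0 1) := variationOnFromTo.monotoneOn hlv h0
  have hvol : volume (τ '' Icc 0 1) ≠ ⊤ := by
    refine ne_top_of_le_ne_top (measure_Icc_lt_top (a := τ 0) (b := τ 1)).ne (measure_mono ?_)
    rintro _ ⟨x, hx, rfl⟩
    exact ⟨hmono h0 hx hx.1, hmono hx h1 hx.2⟩
  refine (hasFlatCover_image_of_lipschitzOnWith hφ hvol hε hε1).mono ?_
  rintro _ ⟨x, hx, rfl⟩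
  refine ⟨τ x, ⟨x, hx, rfl⟩, ?_⟩
  exact edist_eq_zero.1 (edist_naturalParameterization_eq_zero hlv h0 hx)

theorem IsRectifiable.hasFlatCover {B : Set Plane} (hB : IsRectifiable B) {ε : ℝ}
    (hε : 0 < ε) (hε1 : ε ≤ 1) : HasFlatCover ε B := by
  obtain ⟨C, hC, hcurve, rfl⟩ := hB
  rcases C.eq_empty_or_nonempty with rfl | hne
  · exact ⟨fun _ => ∅, fun _ => 0, fun _ => isClosed_empty, fun _ x hx => hx.elim, by simp [length]⟩
  obtain ⟨S, rfl⟩ := hC.exists_eq_range hne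
  choose E θ hcl hfl hnull using fun n => (hcurve (S n) ⟨n, rfl⟩).hasFlatCover hε hε1
  refine ⟨fun n => E n.unpair.1 n.unpair.2, fun n => θ n.unpair.1 n.unpair.2,
    fun n => hcl _ _, fun n => hfl _ _, ?_⟩
  refine measure_mono_null ?_ (measure_iUnion_null hnull)
  rintro x ⟨hx, hn⟩
  obtain ⟨_, ⟨n, rfl⟩, hxn⟩ := hx
  refine mem_iUnion.2 ⟨n, hxn, fun h => hn ?_⟩
  obtain ⟨m, hm⟩ := mem_iUnion.1 h
  exact mem_iUnion.2 ⟨Nat.pair n m, by simpa using hm⟩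

theorem IsRectifiable.measurableSet {B : Set Plane} (hB : IsRectifiable B) : MeasurableSet B := by
  obtain ⟨C, hC, hcurve, rfl⟩ := hB
  refine MeasurableSet.sUnion hC fun S hS => ?_
  obtain ⟨γ, hγ, -, rfl⟩ := hcurve S hS
  exact (isCompact_Icc.image_of_continuousOn hγ).measurableSet

/-! ### Integrated shadows of a rectifiable set -/

/-- On a flat piece the shadow has length at most |cos(α - θ)| + ε times that of the piece; summing
and applying Tonelli gives the bound up to an error ε π |B|, which vanishes as ε → 0 because |B| is
finite. Asking for `M` to work for all θ removes any need to know the tangent at x. -/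
theorem lintegral_volume_image_inner_le {B : Set Plane} (hB : MeasurableSet B)
    (hfin : length B ≠ ⊤) {S : Set (Plane × ℝ)} (hS : MeasurableSet S) {M : Plane → ENNReal}
    (hM : ∀ x ∈ B, ∀ θ, ∫⁻ α in Ioc 0 π,
      ENNReal.ofReal |cos (α - θ)| * S.indicator 1 (x, α) ≤ M x)
    (hcov : ∀ ε : ℝ, 0 < ε → ε ≤ 1 → HasFlatCover ε B) :
    ∫⁻ α in Ioc 0 π, volume ((fun x => inner ℝ (unitVec α) x) '' {x ∈ B | (x, α) ∈ S})
      ≤ ∫⁻ x in B, M x ∂(Measure.hausdorffMeasure 1) := by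
  set μ : Measure Plane := (Measure.hausdorffMeasure 1).restrict B with hμ
  have hμfin : μ univ ≠ ⊤ := by simpa [hμ, length] using hfin
  have : IsFiniteMeasure μ := ⟨lt_top_iff_ne_top.2 hμfin⟩
  have hind : Measurable (S.indicator (1 : Plane × ℝ → ENNReal)) := measurable_one.indicator hS
  have key : ∀ ε : ℝ, 0 < ε → ε ≤ 1 →
      ∫⁻ α in Ioc 0 π, volume ((fun x => inner ℝ (unitVec α) x) '' {x ∈ B | (x, α) ∈ S})
        ≤ ∫⁻ x, M x ∂μ + ENNReal.ofReal ε * (ENNReal.ofReal π * μ univ) := by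
    intro ε hε hε1
    obtain ⟨E, θ, hcl, hfl, hnull⟩ := hcov ε hε hε1
    -- Disjoint pieces, so that no part of `B` is counted twice in the sum.
    set D := disjointed E with hD
    have hDm : ∀ n, MeasurableSet (D n) := MeasurableSet.disjointed fun n => (hcl n).measurableSet
    have hpt : ∀ α, volume ((fun x => inner ℝ (unitVec α) x) '' {x ∈ B | (x, α) ∈ S})
        ≤ ∑' n, ∫⁻ x in D n, ENNReal.ofReal (|cos (α - θ n)| + ε) * S.indicator 1 (x, α) ∂μ := by
      intro α
      have hSα : MeasurableSet {x | (x, α) ∈ S} := measurable_prodMk_right hS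
      have hsub : {x ∈ B | (x, α) ∈ S} ⊆
          (B \ ⋃ n, E n) ∪ ⋃ n, (D n ∩ (B ∩ {x | (x, α) ∈ S})) := by
        rintro x ⟨hx, hxS⟩
        by_cases h : x ∈ ⋃ n, E n
        · rw [← iUnion_disjointed] at h
          obtain ⟨n, hn⟩ := mem_iUnion.1 h
          exact Or.inr (mem_iUnion.2 ⟨n, hn, hx, hxS⟩)
        · exact Or.inl ⟨hx, h⟩
      refine (measure_mono (image_mono hsub)).trans ?_
      rw [image_union, image_iUnion]
      refine (measure_union_le _ _).trans ?_
      have h0 : volume ((fun x => inner ℝ (unitVec α) x) '' (B \ ⋃ n, E n)) = 0 :=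
        le_antisymm ((volume_image_inner_le α _).trans hnull.le) bot_le
      rw [h0, zero_add]
      refine (measure_iUnion_le _).trans (ENNReal.tsum_le_tsum fun n => ?_)
      have hfn : IsFlat ε (θ n) (D n ∩ (B ∩ {x | (x, α) ∈ S})) :=
        (hfl n).mono (inter_subset_left.trans (disjointed_subset E n))
      refine (hfn.volume_image_le hε.le α).trans (le_of_eq ?_)
      rw [lintegral_const_mul _ (by fun_prop)]
      congr 1
      have : ∀ x, S.indicator (1 : Plane × ℝ → ENNReal) (x, α)
          = {x | (x, α) ∈ S}.indicator 1 x := fun x => rfl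
      simp_rw [this]
      rw [lintegral_indicator_one hSα, Measure.restrict_apply hSα, hμ,
        Measure.restrict_apply (hSα.inter (hDm n)), length]
      congr 1
      ext x; simp only [mem_inter_iff]; tauto
    refine (lintegral_mono hpt).trans ?_
    have hjm : ∀ n, Measurable (fun p : ℝ × Plane =>
        ENNReal.ofReal (|cos (p.1 - θ n)| + ε) * S.indicator 1 (p.2, p.1)) := by
      intro n
      refine Measurable.mul (by fun_prop) (hind.comp measurable_swap)
    rw [lintegral_tsum fun n => (Measurable.lintegral_prod_right' (hjm n)).aemeasurable]
    have hn : ∀ n, ∫⁻ α in Ioc 0 π, ∫⁻ x in D n,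
        ENNReal.ofReal (|cos (α - θ n)| + ε) * S.indicator 1 (x, α) ∂μ
        ≤ ∫⁻ x in D n, (M x + ENNReal.ofReal ε * ENNReal.ofReal π) ∂μ := by
      intro n
      rw [lintegral_lintegral_swap (hjm n).aemeasurable]
      refine lintegral_mono_ae ?_
      have hB' : ∀ᵐ x ∂(μ.restrict (D n)), x ∈ B :=
        ae_restrict_of_ae (ae_restrict_mem hB)
      filter_upwards [hB'] with x hx
      calc ∫⁻ α in Ioc 0 π, ENNReal.ofReal (|cos (α - θ n)| + ε) * S.indicator 1 (x, α)
          ≤ ∫⁻ α in Ioc 0 π, (ENNReal.ofReal |cos (α - θ n)| * S.indicator 1 (x, α)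
              + ENNReal.ofReal ε) := by
            refine lintegral_mono fun α => ?_
            dsimp only
            rw [ENNReal.ofReal_add (abs_nonneg _) hε.le, add_mul]
            gcongr
            refine mul_le_of_le_one_right bot_le ?_
            exact indicator_le_self' (fun _ _ => bot_le) _
        _ = (∫⁻ α in Ioc 0 π, ENNReal.ofReal |cos (α - θ n)| * S.indicator 1 (x, α))
              + ENNReal.ofReal ε * ENNReal.ofReal π := by
            rw [lintegral_add_right _ measurable_const]
            simp
        _ ≤ _ := by gcongr; exact hM x hx _
    refine (ENNReal.tsum_le_tsum hn).trans ?_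
    rw [← lintegral_iUnion hDm (disjoint_disjointed E)]
    refine (setLIntegral_le_lintegral _ _).trans (le_of_eq ?_)
    rw [lintegral_add_right _ measurable_const, lintegral_const, mul_assoc]
  have hC : ENNReal.ofReal π * μ univ ≠ ⊤ := ENNReal.mul_ne_top ENNReal.ofReal_ne_top hμfin
  have hlim : Tendsto (fun ε : ℝ => ∫⁻ x, M x ∂μ + ENNReal.ofReal ε * (ENNReal.ofReal π * μ univ))
      (𝓝[>] 0) (𝓝 (∫⁻ x, M x ∂μ + ENNReal.ofReal 0 * (ENNReal.ofReal π * μ univ))) := by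
    refine tendsto_const_nhds.add (ENNReal.Tendsto.mul_const ?_ (Or.inr hC))
    exact (ENNReal.continuous_ofReal.tendsto 0).mono_left nhdsWithin_le_nhds
  rw [ENNReal.ofReal_zero, zero_mul, add_zero] at hlim
  refine ge_of_tendsto hlim ?_
  filter_upwards [Ioc_mem_nhdsGT (zero_lt_one (α := ℝ))] with ε hε using key ε hε.1 hε.2

/-! ### Integrals of |cos| over restricted directions -/

/-- Among all intervals of length `2 * a`, the one centred at a maximum of the absolute value of the
cosine gives it the largest integral. -/
theorem integral_abs_cos_sub_le {a : ℝ} (ha0 : 0 ≤ a) (ha : a ≤ π / 2) (δ : ℝ) :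
    ∫ t in -a..a, |cos (t - δ)| ≤ 2 * sin a := by
  have hpi := pi_pos
  -- Bathtub argument: |cos| is at most cos a plus the excess (|cos| - cos a)⁺. Integrating the
  -- excess over a full period makes the shift δ irrelevant, and unshifted the excess lives on [-a,
  -- a].
  have hper : Function.Periodic (fun t => max (|cos t| - cos a) 0) π := fun t => by
    simp [cos_add_pi]
  have hcont : Continuous (fun t => max (|cos t| - cos a) 0) := by fun_prop
  have hii : ∀ f : ℝ → ℝ, Continuous f → ∀ x y : ℝ, IntervalIntegrable f volume x y :=
    fun f hf x y => hf.intervalIntegrable x y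
  calc ∫ t in -a..a, |cos (t - δ)|
      ≤ ∫ t in -a..a, (cos a + max (|cos (t - δ)| - cos a) 0) := by
        refine intervalIntegral.integral_mono_on (by linarith) (hii _ (by fun_prop) _ _)
          (hii _ (by fun_prop) _ _) fun t _ => ?_
        linarith [le_max_left (|cos (t - δ)| - cos a) 0]
    _ = 2 * a * cos a + ∫ t in -a..a, max (|cos (t - δ)| - cos a) 0 := by
        rw [intervalIntegral.integral_add (hii _ (by fun_prop) _ _) (hii _ (by fun_prop) _ _)]
        rw [intervalIntegral.integral_const, smul_eq_mul]
        ring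
    _ ≤ 2 * a * cos a + ∫ t in -(π / 2)..(π / 2), max (|cos (t - δ)| - cos a) 0 := by
        gcongr
        exact intervalIntegral.integral_mono_interval (by linarith) (by linarith) ha
          (Eventually.of_forall fun t => le_max_right _ _) (hii _ (by fun_prop) _ _)
    _ = 2 * a * cos a + ∫ t in -(π / 2)..(π / 2), max (|cos t| - cos a) 0 := by
        rw [intervalIntegral.integral_comp_sub_right (fun t => max (|cos t| - cos a) 0)]
        have := hper.intervalIntegral_add_eq (-(π / 2) - δ) (-(π / 2))
        rw [show -(π / 2) - δ + π = π / 2 - δ by ring, show -(π / 2) + π = π / 2 by ring] at this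
        rw [this]
    _ = 2 * a * cos a + ∫ t in -a..a, (cos t - cos a) := by
        congr 1
        have hout : ∀ t, a ≤ |t| → |t| ≤ π / 2 → max (|cos t| - cos a) 0 = 0 := by
          intro t h1 h2
          rw [abs_of_nonneg (cos_nonneg_of_mem_Icc ⟨by linarith [neg_abs_le t],
            by linarith [le_abs_self t]⟩), ← cos_abs t]
          exact max_eq_right (sub_nonpos.2 (cos_le_cos_of_nonneg_of_le_pi ha0 (by linarith) h1))
        rw [← intervalIntegral.integral_add_adjacent_intervals (hii _ hcont (-(π / 2)) (-a))
          (hii _ hcont _ _), ← intervalIntegral.integral_add_adjacent_intervals (hii _ hcont (-a) a)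
          (hii _ hcont _ _)]
        have h1 : ∫ t in -(π / 2)..(-a), max (|cos t| - cos a) 0 = 0 := by
          rw [intervalIntegral.integral_congr (g := fun _ => 0), intervalIntegral.integral_zero]
          intro t ht
          rw [uIcc_of_le (by linarith)] at ht
          have : |t| = -t := abs_of_nonpos (by linarith [ht.2])
          exact hout t (by rw [this]; linarith [ht.2]) (by rw [this]; linarith [ht.1])
        have h2 : ∫ t in a..(π / 2), max (|cos t| - cos a) 0 = 0 := by
          rw [intervalIntegral.integral_congr (g := fun _ => 0), intervalIntegral.integral_zero]
          intro t ht
          rw [uIcc_of_le ha] at ht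
          have : |t| = t := abs_of_nonneg (by linarith [ht.1])
          exact hout t (by rw [this]; exact ht.1) (by rw [this]; exact ht.2)
        rw [h1, h2, add_zero, zero_add]
        refine intervalIntegral.integral_congr fun t ht => ?_
        rw [uIcc_of_le (by linarith)] at ht
        have hta : |t| ≤ a := abs_le.2 ht

        rw [abs_of_nonneg (cos_nonneg_of_mem_Icc ⟨by linarith [ht.1], by linarith [ht.2]⟩)]
        refine max_eq_left (sub_nonneg.2 ?_)
        rw [← cos_abs t]
        exact cos_le_cos_of_nonneg_of_le_pi (abs_nonneg t) (by linarith) hta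
    _ = 2 * sin a := by
        rw [intervalIntegral.integral_sub (hii _ (by fun_prop) _ _) (hii _ (by fun_prop) _ _)]
        simp
        ring

/-- Within the period centred at β the condition on α describes the interval [β - a, β + a], so
periodicity reduces to `integral_abs_cos_sub_le`. -/
theorem lintegral_abs_cos_sub_indicator_le {a : ℝ} (ha0 : 0 ≤ a) (ha : a ≤ π / 2) (β θ : ℝ) :
    ∫⁻ α in Ioc 0 π, ENNReal.ofReal |cos (α - θ)| * {α | cos a ≤ |cos (α - β)|}.indicator 1 α
      ≤ ENNReal.ofReal (2 * sin a) := by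
  have hpi := pi_pos
  set g : ℝ → ENNReal := fun α =>
    ENNReal.ofReal |cos (α - θ)| * {α | cos a ≤ |cos (α - β)|}.indicator 1 α with hg
  have hper : Function.Periodic g π := fun t => by
    simp only [hg, indicator, mem_ofPred_eq, add_sub_right_comm, cos_add_pi, abs_neg, Pi.one_apply]
  have h1 : ∫⁻ α in Ioc 0 π, g α = ∫⁻ α in Ioc (β - π / 2) (β + π / 2), g α := by
    have hd1 := isAddFundamentalDomain_Ioc hpi 0
    have hd2 := isAddFundamentalDomain_Ioc hpi (β - π / 2)
    rw [zero_add] at hd1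
    rw [show β - π / 2 + π = β + π / 2 by ring] at hd2
    exact hd1.setLIntegral_eq hd2 g fun v x => by
      obtain ⟨v, hv⟩ := v
      obtain ⟨n, rfl⟩ := AddSubgroup.mem_zmultiples_iff.1 hv
      change g (n • π + x) = g x
      rw [add_comm]
      exact (hper.zsmul n) x
  have h2 : ∀ α ∈ Ioc (β - π / 2) (β + π / 2), g α ≤
      (Icc (β - a) (β + a)).indicator (fun α => ENNReal.ofReal |cos (α - θ)|) α := by
    intro α hα
    by_cases hc : cos a ≤ |cos (α - β)|
    · have hin : α ∈ Icc (β - a) (β + a) := by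
        rw [abs_of_nonneg (cos_nonneg_of_mem_Icc ⟨by linarith [hα.1], by linarith [hα.2]⟩),
          ← cos_abs (α - β)] at hc
        have hab : |α - β| ≤ π / 2 := abs_le.2 ⟨by linarith [hα.1], by linarith [hα.2]⟩
        have := (strictAntiOn_cos.le_iff_ge ⟨ha0, by linarith⟩
          ⟨abs_nonneg (α - β), by linarith⟩).1 hc
        exact ⟨by linarith [(abs_le.1 this).1], by linarith [(abs_le.1 this).2]⟩
      rw [indicator_of_mem hin, hg]
      exact mul_le_of_le_one_right bot_le (indicator_le_self' (fun _ _ => bot_le) _)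
    · have : g α = 0 := by simp [hg, hc]
      rw [this]; exact bot_le
  rw [h1]
  calc ∫⁻ α in Ioc (β - π / 2) (β + π / 2), g α
      ≤ ∫⁻ α in Ioc (β - π / 2) (β + π / 2),
          (Icc (β - a) (β + a)).indicator (fun α => ENNReal.ofReal |cos (α - θ)|) α :=
        setLIntegral_mono' measurableSet_Ioc h2
    _ ≤ ∫⁻ α, (Icc (β - a) (β + a)).indicator (fun α => ENNReal.ofReal |cos (α - θ)|) α :=
        setLIntegral_le_lintegral _ _
    _ = ENNReal.ofReal (∫ α in Ioc (β - a) (β + a), |cos (α - θ)|) := by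
        rw [lintegral_indicator measurableSet_Icc, ofReal_integral_eq_lintegral_ofReal
          ((Continuous.integrableOn_Ioc (by fun_prop))) (Eventually.of_forall fun _ => abs_nonneg _)]
        exact setLIntegral_congr Ioc_ae_eq_Icc.symm
    _ ≤ ENNReal.ofReal (2 * sin a) := by
        refine ENNReal.ofReal_le_ofReal ?_
        rw [← intervalIntegral.integral_of_le (by linarith)]
        refine le_trans (le_of_eq ?_) (integral_abs_cos_sub_le ha0 ha (θ - β))
        have := intervalIntegral.integral_comp_sub_right (a := β - a) (b := β + a)
          (fun t => |cos (t - (θ - β))|) β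
        simp only [sub_sub_sub_cancel_right, sub_sub_cancel_left, add_sub_cancel_left] at this
        simpa [sub_sub] using this

/-! ### Support functions and the perimeter inequality -/

/-- The support function of a plane set. -/
noncomputable def supportFn (K : Set Plane) (w : Plane) : ℝ := sSup ((fun x => inner ℝ w x) '' K)

theorem continuous_supportFn {K : Set Plane} (hK : IsCompact K) : Continuous (supportFn K) :=
  hK.continuous_sSup (f := fun w x => inner ℝ w x) (by unfold Function.HasUncurry.uncurry; fun_prop)

theorem inner_le_supportFn {K : Set Plane} (hK : IsCompact K) (w : Plane) {x : Plane}
    (hx : x ∈ K) : inner ℝ w x ≤ supportFn K w :=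
  le_csSup (hK.image (by fun_prop)).bddAbove ⟨x, hx, rfl⟩

theorem exists_inner_eq_supportFn {K : Set Plane} (hK : IsCompact K) (hne : K.Nonempty)
    (w : Plane) : ∃ x ∈ K, inner ℝ w x = supportFn K w :=
  (hK.image (f := fun x => inner ℝ w x) (by fun_prop)).sSup_mem (hne.image _)

theorem ofReal_supportFn_add_le_volume_image {K : Set Plane} (hK : IsCompact K)
    (hconv : Convex ℝ K) (hne : K.Nonempty) (α : ℝ) :
    ENNReal.ofReal (supportFn K (unitVec α) + supportFn K (unitVec (α + π)))
      ≤ volume ((fun x => inner ℝ (unitVec α) x) '' K) := by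
  obtain ⟨x, hx, hxe⟩ := exists_inner_eq_supportFn hK hne (unitVec α)
  obtain ⟨y, hy, hye⟩ := exists_inner_eq_supportFn hK hne (unitVec (α + π))
  rw [← hxe, ← hye, unitVec_add_pi, inner_neg_left, ← sub_eq_add_neg, ← Real.volume_Icc]
  refine measure_mono ?_
  have hc : Convex ℝ ((fun x => inner ℝ (unitVec α) x) '' K) :=
    hconv.linear_image (innerₛₗ ℝ (unitVec α))
  exact hc.ordConnected.out ⟨y, hy, rfl⟩ ⟨x, hx, rfl⟩

/-- Evaluate all three terms at a point of `K` extremal in direction α. This makes the side lengths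
of the circumscribed polygons nonnegative. -/
theorem two_cos_mul_supportFn_le {K : Set Plane} (hK : IsCompact K) (hne : K.Nonempty)
    (α δ : ℝ) : 2 * cos δ * supportFn K (unitVec α)
      ≤ supportFn K (unitVec (α + δ)) + supportFn K (unitVec (α - δ)) := by
  obtain ⟨x, hx, hxe⟩ := exists_inner_eq_supportFn hK hne (unitVec α)
  have h1 := inner_le_supportFn hK (unitVec (α + δ)) hx
  have h2 := inner_le_supportFn hK (unitVec (α - δ)) hx
  have h3 : inner ℝ (unitVec (α + δ)) x + inner ℝ (unitVec (α - δ)) x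
      = 2 * cos δ * inner ℝ (unitVec α) x := by
    simp only [inner_unitVec, cos_add, sin_add, cos_sub, sin_sub]; ring
  rw [← hxe]; linarith

/-- The metric projection onto `K` does not increase distances, hence not lengths. -/
theorem length_le_of_forall_exists_normal {K F Z : Set Plane} (hFK : F ⊆ K)
    (h : ∀ q ∈ F, ∃ z ∈ Z, ∀ y ∈ K, inner ℝ (z - q) (y - q) ≤ 0) : length F ≤ length Z := by
  rcases F.eq_empty_or_nonempty with rfl | ⟨q₀, hq₀⟩
  · simp [length]
  have : Nonempty Plane := ⟨q₀⟩
  choose! g hgZ hg using h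
  -- `g` picks a preimage under the projection; adding the two normal-cone inequalities shows that
  -- it expands distances, so its inverse is 1-Lipschitz.
  have hexp : ∀ p ∈ F, ∀ q ∈ F, ‖p - q‖ ≤ ‖g p - g q‖ := by
    intro p hp q hq
    have h1 := hg p hp q (hFK hq)
    have h2 := hg q hq p (hFK hp)
    have h3 : ‖p - q‖ ^ 2 ≤ inner ℝ (g p - g q) (p - q) := by
      have e : inner ℝ (g p - g q) (p - q) = ‖p - q‖ ^ 2
          - inner ℝ (g p - p) (q - p) - inner ℝ (g q - q) (p - q) := by
        rw [← real_inner_self_eq_norm_sq, show q - p = -(p - q) by abel, inner_neg_right,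
          sub_neg_eq_add, ← inner_add_left, ← inner_sub_left]
        congr 1; abel
      linarith
    have h4 := real_inner_le_norm (g p - g q) (p - q)
    rcases (norm_nonneg (p - q)).eq_or_lt with h0 | h0
    · rw [← h0]; exact norm_nonneg _
    · exact le_of_mul_le_mul_right (by nlinarith) h0
  have hinj : InjOn g F := by
    intro p hp q hq hpq
    have := hexp p hp q hq
    rw [hpq, sub_self, norm_zero] at this
    exact sub_eq_zero.1 (norm_le_zero_iff.1 this)
  have hleft : LeftInvOn (Function.invFunOn g F) g F := hinj.leftInvOn_invFunOn
  have hl : LipschitzOnWith 1 (Function.invFunOn g F) (g '' F) := by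
    refine LipschitzOnWith.of_dist_le_mul ?_
    rintro _ ⟨p, hp, rfl⟩ _ ⟨q, hq, rfl⟩
    rw [hleft hp, hleft hq, dist_eq_norm, dist_eq_norm]
    simpa using hexp p hp q hq
  have := hl.hausdorffMeasure_image_le (d := 1) zero_le_one
  rw [hleft.image_image] at this
  refine le_trans ?_ (measure_mono (image_subset_iff.2 hgZ))
  simpa [length] using this

/-- The part of a line with normal direction `α` cut out by an interval. -/
noncomputable def side (c α a b : ℝ) : Set Plane :=
  (fun s : ℝ => c • unitVec α + s • unitVec (α + π / 2)) '' Icc a b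

theorem length_side_le (c α a b : ℝ) : length (side c α a b) ≤ ENNReal.ofReal (b - a) := by
  have hl : LipschitzWith 1 (fun s : ℝ => c • unitVec α + s • unitVec (α + π / 2)) := by
    refine LipschitzWith.of_dist_le_mul fun s t => ?_
    rw [dist_eq_norm, add_sub_add_left_eq_sub, ← sub_smul, norm_smul, norm_unitVec, Real.dist_eq]
    simp
  have := hl.hausdorffMeasure_image_le (d := 1) zero_le_one (Icc a b)
  simpa [hausdorffMeasure_real, length, side] using this

theorem exists_normal_of_mem_frontier {K : Set Plane} (hconv : Convex ℝ K)
    (hint : (interior K).Nonempty) {q : Plane} (hq : q ∈ frontier K) :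
    ∃ w : Plane, w ≠ 0 ∧ ∀ y ∈ K, inner ℝ w (y - q) ≤ 0 := by
  obtain ⟨f, hf0, hf⟩ := geometric_hahn_banach_of_nonempty_interior_point hconv hq.2 hint
  refine ⟨(InnerProductSpace.toDual ℝ Plane).symm f, by simpa using hf0, fun y hy => ?_⟩
  rw [InnerProductSpace.toDual_symm_apply, map_sub]
  exact sub_nonpos.2 (hf y hy)

/-- Lets the neighbours k ± 1 of a side, and the normal nearest to a given direction, wrap around
modulo n. -/
theorem exists_nat_unitVec_eq {n : ℕ} (hn : 0 < n) (φ : ℝ) (k : ℤ) :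
    ∃ j < n, unitVec (φ + j * (2 * π / n)) = unitVec (φ + k * (2 * π / n)) := by
  have hn' : (n : ℤ) ≠ 0 := by exact_mod_cast hn.ne'
  have h1 := Int.emod_nonneg k hn'
  have h2 := Int.emod_lt_of_pos k (by exact_mod_cast hn : (0 : ℤ) < n)
  refine ⟨(k % n).toNat, by omega, ?_⟩
  have h3 : (((k % n).toNat : ℕ) : ℝ) = ((k % n : ℤ) : ℝ) := by
    exact_mod_cast Int.toNat_of_nonneg h1
  have h4 : (k : ℝ) = n * ((k / n : ℤ) : ℝ) + ((k % n : ℤ) : ℝ) := by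
    exact_mod_cast (Int.mul_ediv_add_emod k n).symm
  have hnr : (n : ℝ) ≠ 0 := by exact_mod_cast hn.ne'
  rw [h3, ← unitVec_add_two_pi_int _ (k / n)]
  congr 1
  rw [h4]
  field_simp
  ring

/-- The sides of the circumscribed equiangular polygons dominate the length of the boundary. -/
theorem length_frontier_le_sum {K : Set Plane} (hK : IsCompact K) (hconv : Convex ℝ K)
    (hint : (interior K).Nonempty) {n : ℕ} (hn : 5 ≤ n) (φ : ℝ) :
    length (frontier K) ≤ ENNReal.ofReal (∑ k ∈ Finset.range n,
      (supportFn K (unitVec (φ + k * (2 * π / n) + 2 * π / n))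
        + supportFn K (unitVec (φ + k * (2 * π / n) - 2 * π / n))
        - 2 * cos (2 * π / n) * supportFn K (unitVec (φ + k * (2 * π / n)))) / sin (2 * π / n)) := by
  have hpi := pi_pos
  have hne : K.Nonempty := hint.mono interior_subset
  have hn5 : (5 : ℝ) ≤ n := by exact_mod_cast hn
  have hn0 : (0 : ℝ) < n := by linarith
  set δ := 2 * π / n with hδ
  have hδ0 : 0 < δ := by positivity
  have hδ1 : δ < π / 2 := by
    rw [hδ, div_lt_iff₀ hn0]; nlinarith
  have hsin : 0 < sin δ := sin_pos_of_pos_of_lt_pi hδ0 (by linarith)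
  set h := supportFn K with hh
  set a : ℕ → ℝ := fun k => φ + k * δ with ha
  -- On the k-th supporting line, the constraints of the two adjacent normals cut out exactly these
  -- bounds for the tangential coordinate.
  set Z : Set Plane := ⋃ k ∈ Finset.range n, side (h (unitVec (a k))) (a k)
    (-((h (unitVec (a k - δ)) - h (unitVec (a k)) * cos δ) / sin δ))
    ((h (unitVec (a k + δ)) - h (unitVec (a k)) * cos δ) / sin δ) with hZ
  have hZl : length Z ≤ ENNReal.ofReal (∑ k ∈ Finset.range n,
      (h (unitVec (a k + δ)) + h (unitVec (a k - δ)) - 2 * cos δ * h (unitVec (a k))) / sin δ) := by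
    rw [ENNReal.ofReal_sum_of_nonneg fun k _ => div_nonneg
      (sub_nonneg.2 (two_cos_mul_supportFn_le hK hne _ _)) hsin.le]
    refine (measure_biUnion_finset_le _ _).trans (Finset.sum_le_sum fun k _ => ?_)
    refine (length_side_le _ _ _ _).trans (ENNReal.ofReal_le_ofReal (le_of_eq ?_))
    field_simp; ring
  refine le_trans (length_le_of_forall_exists_normal hK.isClosed.frontier_subset ?_) hZl
  intro q hq
  obtain ⟨w, hw0, hw⟩ := exists_normal_of_mem_frontier hconv hint hq
  have hqK : q ∈ K := hK.isClosed.frontier_subset hq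
  set P := (Finset.range n).filter fun k => 0 < inner ℝ (unitVec (a k)) w with hP
  have hPne : P.Nonempty := by
    obtain ⟨ψ, hψ⟩ := exists_eq_norm_smul_unitVec w
    -- The normal nearest to the direction of `w` is within δ / 2 of it.
    obtain ⟨j, hj, hje⟩ := exists_nat_unitVec_eq (by omega : 0 < n) φ (round ((ψ - φ) / δ))
    refine ⟨j, Finset.mem_filter.2 ⟨Finset.mem_range.2 hj, ?_⟩⟩
    change 0 < inner ℝ (unitVec (φ + j * (2 * π / n))) w
    rw [hje, hψ, inner_smul_right, inner_unitVec_unitVec]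
    refine mul_pos (norm_pos_iff.2 hw0) (cos_pos_of_mem_Ioo ?_)
    have hr := abs_sub_round ((ψ - φ) / δ)
    rw [← hδ]
    have e : φ + round ((ψ - φ) / δ) * δ - ψ = -(((ψ - φ) / δ - round ((ψ - φ) / δ)) * δ) := by
      field_simp; ring
    rw [e]
    rw [abs_le] at hr
    constructor <;> nlinarith
  obtain ⟨k, hk, hmin⟩ := P.exists_min_image
    (fun k => (h (unitVec (a k)) - inner ℝ (unitVec (a k)) q) / inner ℝ (unitVec (a k)) w) hPne
  -- The ray from `q` along its outer normal `w` first meets a supporting line at time `t`; there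
  -- all the other constraints still hold, so the point lies on a side.
  set t := (h (unitVec (a k)) - inner ℝ (unitVec (a k)) q) / inner ℝ (unitVec (a k)) w with ht
  have hkw : 0 < inner ℝ (unitVec (a k)) w := (Finset.mem_filter.1 hk).2
  have hkn : k ∈ Finset.range n := (Finset.mem_filter.1 hk).1
  have ht0 : 0 ≤ t := div_nonneg (sub_nonneg.2 (inner_le_supportFn hK _ hqK)) hkw.le
  have hle : ∀ j < n, inner ℝ (unitVec (a j)) (q + t • w) ≤ h (unitVec (a j)) := by
    intro j hj
    rw [inner_add_right, inner_smul_right]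
    by_cases hjw : 0 < inner ℝ (unitVec (a j)) w
    · have := hmin j (Finset.mem_filter.2 ⟨Finset.mem_range.2 hj, hjw⟩)
      rw [le_div_iff₀ hjw] at this
      linarith
    · have h1 : inner ℝ (unitVec (a j)) q ≤ h (unitVec (a j)) := inner_le_supportFn hK _ hqK
      have h2 := mul_nonpos_of_nonneg_of_nonpos ht0 (not_lt.1 hjw)
      linarith
  have hle' : ∀ m : ℤ, inner ℝ (unitVec (φ + m * δ)) (q + t • w) ≤ h (unitVec (φ + m * δ)) := by
    intro m
    obtain ⟨j, hj, hje⟩ := exists_nat_unitVec_eq (by omega : 0 < n) φ m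
    rw [← hδ] at hje
    rw [← hje]
    exact hle j hj
  refine ⟨q + t • w, ?_, fun y hy => ?_⟩
  · set z := q + t • w with hz
    have hzk : inner ℝ (unitVec (a k)) z = h (unitVec (a k)) := by
      rw [hz, inner_add_right, inner_smul_right, ht, div_mul_cancel₀ _ hkw.ne']; ring
    have hdec := eq_inner_smul_unitVec_add (a k) z
    set s := inner ℝ (unitVec (a k + π / 2)) z with hs
    have hplus := hle' (k + 1)
    have hminus := hle' (k - 1)
    have e1 : φ + ((k + 1 : ℤ) : ℝ) * δ = a k + δ := by simp only [ha]; push_cast; ring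
    have e2 : φ + ((k - 1 : ℤ) : ℝ) * δ = a k - δ := by simp only [ha]; push_cast; ring
    rw [e1] at hplus
    rw [e2] at hminus
    rw [hzk] at hdec
    have i1 : inner ℝ (unitVec (a k + δ)) z = h (unitVec (a k)) * cos δ + s * sin δ := by
      rw [hdec, inner_add_right, inner_smul_right, inner_smul_right, inner_unitVec_unitVec,
        inner_unitVec_unitVec, add_sub_cancel_left, add_sub_add_left_eq_sub, cos_sub_pi_div_two]
    have i2 : inner ℝ (unitVec (a k - δ)) z = h (unitVec (a k)) * cos δ - s * sin δ := by
      rw [hdec, inner_add_right, inner_smul_right, inner_smul_right, inner_unitVec_unitVec,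
        inner_unitVec_unitVec, sub_sub_cancel_left, cos_neg,
        show a k - δ - (a k + π / 2) = -(δ + π / 2) by ring, cos_neg, cos_add_pi_div_two]
      ring
    refine mem_biUnion (x := k) hkn ⟨s, ⟨?_, ?_⟩, hdec.symm⟩
    · rw [neg_le, le_div_iff₀ hsin]; linarith
    · rw [le_div_iff₀ hsin]; linarith
  · rw [add_sub_cancel_left, real_inner_smul_left]
    exact mul_nonpos_of_nonneg_of_nonpos ht0 (hw y hy)

/-- Averaging the polygon bound over all rotations. -/
theorem length_frontier_le_integral {K : Set Plane} (hK : IsCompact K) (hconv : Convex ℝ K)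
    (hint : (interior K).Nonempty) {n : ℕ} (hn : 5 ≤ n) :
    length (frontier K) ≠ ⊤ ∧ 2 * π * (length (frontier K)).toReal
      ≤ n * ((2 - 2 * cos (2 * π / n)) / sin (2 * π / n))
        * ∫ φ in 0..2 * π, supportFn K (unitVec φ) := by
  have hpi := pi_pos
  have hne : K.Nonempty := hint.mono interior_subset
  have hn5 : (5 : ℝ) ≤ n := by exact_mod_cast hn
  have hn0 : (0 : ℝ) < n := by linarith
  have hs := length_frontier_le_sum hK hconv hint hn
  set δ := 2 * π / n with hδ
  have hδ0 : 0 < δ := by positivity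
  have hδ1 : δ < π / 2 := by
    rw [hδ, div_lt_iff₀ hn0]; nlinarith
  have hsin : 0 < sin δ := sin_pos_of_pos_of_lt_pi hδ0 (by linarith)
  set h : ℝ → ℝ := fun φ => supportFn K (unitVec φ) with hh
  have hcont : Continuous h := (continuous_supportFn hK).comp continuous_unitVec
  have hper : Function.Periodic h (2 * π) := fun φ => by
    have := unitVec_add_two_pi_int φ 1
    rw [Int.cast_one, one_mul] at this
    simp only [hh, this]
  have hshift : ∀ c, ∫ φ in 0..2 * π, h (φ + c) = ∫ φ in 0..2 * π, h φ := by
    intro c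
    rw [intervalIntegral.integral_comp_add_right]
    have := hper.intervalIntegral_add_eq (0 + c) 0
    rw [zero_add, zero_add, add_comm c] at this
    rwa [zero_add]
  refine ⟨ne_top_of_le_ne_top ENNReal.ofReal_ne_top (hs 0), ?_⟩
  have hpt : ∀ φ, (length (frontier K)).toReal ≤ ∑ k ∈ Finset.range n,
      (h (φ + (k * δ + δ)) + h (φ + (k * δ - δ)) - 2 * cos δ * h (φ + k * δ)) / sin δ := by
    intro φ
    refine ENNReal.toReal_le_of_le_ofReal (Finset.sum_nonneg fun k _ => div_nonneg ?_ hsin.le) ?_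
    · have := two_cos_mul_supportFn_le hK hne (φ + k * δ) δ
      rw [add_assoc, add_sub_assoc] at this
      exact sub_nonneg.2 this
    · refine (hs φ).trans (le_of_eq ?_)
      simp only [hh, add_assoc, add_sub_assoc]
  have hii : ∀ f : ℝ → ℝ, Continuous f → IntervalIntegrable f volume 0 (2 * π) :=
    fun f hf => hf.intervalIntegrable _ _
  have hint := intervalIntegral.integral_mono_on (by positivity : (0 : ℝ) ≤ 2 * π)
    (hii _ continuous_const) (hii _ (by fun_prop)) fun φ _ => hpt φ
  rw [intervalIntegral.integral_const, intervalIntegral.integral_finsetSum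
    (fun k _ => hii _ (by fun_prop))] at hint
  have hterm : ∀ k ∈ Finset.range n, ∫ φ in 0..2 * π,
      (h (φ + (k * δ + δ)) + h (φ + (k * δ - δ)) - 2 * cos δ * h (φ + k * δ)) / sin δ
      = (2 - 2 * cos δ) / sin δ * ∫ φ in 0..2 * π, h φ := by
    intro k _
    rw [intervalIntegral.integral_div, intervalIntegral.integral_sub (hii _ (by fun_prop))
      (hii _ (by fun_prop)), intervalIntegral.integral_add (hii _ (by fun_prop))
      (hii _ (by fun_prop)), intervalIntegral.integral_const_mul, hshift, hshift, hshift]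
    ring
  rw [Finset.sum_congr rfl hterm] at hint
  simp only [sub_zero, smul_eq_mul, Finset.sum_const, Finset.card_range, nsmul_eq_mul] at hint
  linarith

/-- By the half-angle formula the n-th term is 2n tan(π / n), and tan has slope 1 at 0. -/
theorem tendsto_nat_mul_two_sub_two_cos_div_sin :
    Tendsto (fun n : ℕ => (n : ℝ) * ((2 - 2 * cos (2 * π / n)) / sin (2 * π / n))) atTop
      (𝓝 (2 * π)) := by
  have hpi := pi_pos
  have h1 : Tendsto (fun n : ℕ => π / (n : ℝ)) atTop (𝓝[≠] 0) := by
    refine tendsto_nhdsWithin_iff.2 ⟨tendsto_const_div_atTop_nhds_zero_nat π, ?_⟩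
    filter_upwards [eventually_gt_atTop 0] with n hn
    have : (0 : ℝ) < n := by exact_mod_cast hn
    exact (div_pos hpi this).ne'
  have h2 : Tendsto (fun x : ℝ => x⁻¹ * tan x) (𝓝[≠] 0) (𝓝 1) := by
    have := (hasDerivAt_tan (x := 0) (by simp)).tendsto_slope_zero
    simpa using this
  have h3 := (h2.comp h1).const_mul (2 * π)
  rw [mul_one] at h3
  refine h3.congr' ?_
  filter_upwards [eventually_ge_atTop 5] with n hn
  have hn5 : (5 : ℝ) ≤ n := by exact_mod_cast hn
  have hn0 : (0 : ℝ) < n := by linarith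
  set x := π / (n : ℝ) with hx
  have hx0 : 0 < x := by positivity
  have hx1 : x < π / 2 := by
    rw [hx, div_lt_iff₀ hn0]; nlinarith
  have hc : cos x ≠ 0 := (cos_pos_of_mem_Ioo ⟨by linarith, hx1⟩).ne'
  have hsx : sin x ≠ 0 := (sin_pos_of_pos_of_lt_pi hx0 (by linarith)).ne'
  have e : 2 * π / n = 2 * x := by rw [hx]; ring
  have en : (n : ℝ) = π / x := by rw [hx]; field_simp
  simp only [Function.comp_apply, ← hx]
  rw [e, cos_two_mul, sin_two_mul, tan_eq_sin_div_cos, en]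
  have hss : sin x ^ 2 = 1 - cos x ^ 2 := sin_sq x
  field_simp
  linear_combination 2 * hss

/-- Folding the full circle onto (0, π] pairs opposite directions, whose support values add up to
the width. -/
theorem lintegral_volume_image_ge_integral_supportFn {K : Set Plane} (hK : IsCompact K)
    (hconv : Convex ℝ K) (hne : K.Nonempty) :
    ENNReal.ofReal (∫ φ in 0..2 * π, supportFn K (unitVec φ))
      ≤ ∫⁻ α in Ioc 0 π, volume ((fun x => inner ℝ (unitVec α) x) '' K) := by
  have hpi := pi_pos
  set h : ℝ → ℝ := fun φ => supportFn K (unitVec φ) with hh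
  have hcont : Continuous h := (continuous_supportFn hK).comp continuous_unitVec
  have h1 : ∫ φ in 0..2 * π, h φ = ∫ φ in 0..π, (h φ + h (φ + π)) := by
    rw [intervalIntegral.integral_add (hcont.intervalIntegrable _ _)
      ((by fun_prop : Continuous fun φ => h (φ + π)).intervalIntegrable _ _),
      intervalIntegral.integral_comp_add_right, zero_add, ← two_mul,
      intervalIntegral.integral_add_adjacent_intervals (hcont.intervalIntegrable _ _)
      (hcont.intervalIntegrable _ _)]
  have h0 : ∀ φ, 0 ≤ h φ + h (φ + π) := by
    intro φ
    obtain ⟨x, hx⟩ := hne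
    have h2 := inner_le_supportFn hK (unitVec φ) hx
    have h3 := inner_le_supportFn hK (unitVec (φ + π)) hx
    rw [unitVec_add_pi, inner_neg_left, ← unitVec_add_pi] at h3
    simp only [hh]; linarith
  rw [h1, intervalIntegral.integral_of_le hpi.le, ofReal_integral_eq_lintegral_ofReal
    ((Continuous.integrableOn_Ioc (by fun_prop))) (Eventually.of_forall h0)]
  exact lintegral_mono fun α => ofReal_supportFn_add_le_volume_image hK hconv hne α

theorem length_frontier_le_lintegral_volume_image {K : Set Plane} (hK : IsCompact K)
    (hconv : Convex ℝ K) (hint : (interior K).Nonempty) :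
    length (frontier K) ≤ ∫⁻ α in Ioc 0 π, volume ((fun x => inner ℝ (unitVec α) x) '' K) := by
  have hpi := pi_pos
  refine le_trans ?_ (lintegral_volume_image_ge_integral_supportFn hK hconv
    (hint.mono interior_subset))
  have hfin := (length_frontier_le_integral hK hconv hint le_rfl).1
  rw [← ENNReal.ofReal_toReal hfin]
  refine ENNReal.ofReal_le_ofReal ?_
  have hlim := tendsto_nat_mul_two_sub_two_cos_div_sin.mul_const
    (∫ φ in 0..2 * π, supportFn K (unitVec φ))
  have := ge_of_tendsto hlim ((eventually_ge_atTop 5).mono fun n hn =>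
    (length_frontier_le_integral hK hconv hint hn).2)
  exact le_of_mul_le_mul_left this (by positivity)

theorem integral_abs_cos_sub (θ : ℝ) : ∫ α in 0..π, |cos (α - θ)| = 2 := by
  have hpi := pi_pos
  have hper : Function.Periodic (fun t => |cos t|) π := fun t => by simp [cos_add_pi]
  rw [intervalIntegral.integral_comp_sub_right (fun t => |cos t|)]
  have := hper.intervalIntegral_add_eq (0 - θ) (-(π / 2))
  rw [show 0 - θ + π = π - θ by ring, show -(π / 2) + π = π / 2 by ring] at this
  rw [this, intervalIntegral.integral_congr (g := cos)]
  · rw [integral_cos]; simp; norm_num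
  · intro t ht
    rw [uIcc_of_le (by linarith)] at ht
    exact abs_of_nonneg (cos_nonneg_of_mem_Icc ht)

theorem exists_unitVec_inner_sub_eq_zero {K : Set Plane} (hconv : Convex ℝ K) (hne : K.Nonempty)
    (hint : ¬ (interior K).Nonempty) :
    ∃ θ, ∀ x ∈ K, ∀ y ∈ K, inner ℝ (unitVec θ) (x - y) = 0 := by
  rw [hconv.interior_nonempty_iff_affineSpan_eq_top,
    ← AffineSubspace.direction_eq_top_iff_of_nonempty ((affineSpan_nonempty ℝ).2 hne),
    direction_affineSpan] at hint
  have h1 : (vectorSpan ℝ K)ᗮ ≠ ⊥ := fun h => hint ((Submodule.orthogonal_eq_bot_iff).1 h)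
  obtain ⟨w, hw, hw0⟩ := Submodule.exists_mem_ne_zero_of_ne_bot h1
  obtain ⟨θ, hθ⟩ := exists_eq_norm_smul_unitVec w
  refine ⟨θ, fun x hx y hy => ?_⟩
  have h2 := (Submodule.mem_orthogonal' _ _).1 hw _ (vsub_mem_vectorSpan ℝ hx hy)
  rw [vsub_eq_sub, hθ, real_inner_smul_left] at h2
  exact (mul_eq_zero.1 h2).resolve_left (norm_ne_zero_iff.2 hw0)

/-- A segment of length L has shadows of length L |cos|, with integral 2L: this is why degenerate
sets count twice. -/
theorem two_mul_length_le_lintegral_volume_image {K : Set Plane} (hK : IsCompact K)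
    (hconv : Convex ℝ K) (hint : ¬ (interior K).Nonempty) :
    2 * length K ≤ ∫⁻ α in Ioc 0 π, volume ((fun x => inner ℝ (unitVec α) x) '' K) := by
  have hpi := pi_pos
  rcases K.eq_empty_or_nonempty with rfl | hne
  · simp [length]
  obtain ⟨θ, hθ⟩ := exists_unitVec_inner_sub_eq_zero hconv hne hint
  set v := unitVec (θ + π / 2) with hv
  obtain ⟨x, hx, hxe⟩ := exists_inner_eq_supportFn hK hne v
  obtain ⟨y, hy, hye⟩ := exists_inner_eq_supportFn hK hne (-v)
  set L := inner ℝ v (x - y) with hL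
  have hmax : ∀ z ∈ K, inner ℝ v z ≤ inner ℝ v x := fun z hz => by
    rw [hxe]; exact inner_le_supportFn hK v hz
  have hmin : ∀ z ∈ K, inner ℝ v y ≤ inner ℝ v z := fun z hz => by
    have := inner_le_supportFn hK (-v) hz
    rw [← hye, inner_neg_left, inner_neg_left] at this
    linarith
  have hL0 : 0 ≤ L := by rw [hL, inner_sub_right]; exact sub_nonneg.2 (hmin x hx)
  have hlen : length K ≤ ENNReal.ofReal L := by
    have hsub : K ⊆ side (inner ℝ (unitVec θ) x) θ (inner ℝ v y) (inner ℝ v x) := by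
      intro z hz
      refine ⟨inner ℝ v z, ⟨hmin z hz, hmax z hz⟩, ?_⟩
      have h1 := hθ x hx z hz
      rw [inner_sub_right, sub_eq_zero] at h1
      rw [h1]
      exact (eq_inner_smul_unitVec_add θ z).symm
    refine (measure_mono hsub).trans ((length_side_le _ _ _ _).trans (le_of_eq ?_))
    rw [hL, inner_sub_right]
  have hxy : x - y = L • v := by
    have := eq_inner_smul_unitVec_add θ (x - y)
    rwa [hθ x hx y hy, zero_smul, zero_add] at this
  have hpt : ∀ α, ENNReal.ofReal (L * |cos (α - (θ + π / 2))|)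
      ≤ volume ((fun x => inner ℝ (unitVec α) x) '' K) := by
    intro α
    have hc : Convex ℝ ((fun x => inner ℝ (unitVec α) x) '' K) :=
      hconv.linear_image (innerₛₗ ℝ (unitVec α))
    have hsub := hc.ordConnected.uIcc_subset ⟨y, hy, rfl⟩ ⟨x, hx, rfl⟩
    refine le_trans (le_of_eq ?_) (measure_mono hsub)
    rw [Real.volume_interval]
    dsimp only
    rw [← inner_sub_right, hxy, inner_smul_right, hv, inner_unitVec_unitVec, abs_mul,
      abs_of_nonneg hL0]
  calc 2 * length K ≤ ENNReal.ofReal (L * 2) := by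
        rw [mul_comm, ENNReal.ofReal_mul hL0]
        simpa using mul_le_mul_left hlen 2
    _ = ENNReal.ofReal (∫ α in Ioc 0 π, L * |cos (α - (θ + π / 2))|) := by
        rw [← intervalIntegral.integral_of_le hpi.le, intervalIntegral.integral_const_mul,
          integral_abs_cos_sub]
    _ = ∫⁻ α in Ioc 0 π, ENNReal.ofReal (L * |cos (α - (θ + π / 2))|) :=
        ofReal_integral_eq_lintegral_ofReal (Continuous.integrableOn_Ioc (by fun_prop))
          (Eventually.of_forall fun _ => mul_nonneg hL0 (abs_nonneg _))
    _ ≤ _ := lintegral_mono hpt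

/-- One half of Cauchy's formula: the perimeter is at most the integral of the width. -/
theorem perimeter_le_lintegral_volume_image {K : Set Plane} (hK : IsCompact K)
    (hconv : Convex ℝ K) :
    perimeter K ≤ ∫⁻ α in Ioc 0 π, volume ((fun x => inner ℝ (unitVec α) x) '' K) := by
  unfold perimeter
  split_ifs with hint
  · exact length_frontier_le_lintegral_volume_image hK hconv hint
  · exact two_mul_length_le_lintegral_volume_image hK hconv hint

/-! ### Lines through barrier points and the view angle -/

/-- The pairs of a point `x` and an angle `α` such that the line through `x` with normal direction
`α` meets `K`. -/
def meetSet (K : Set Plane) : Set (Plane × ℝ) :=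
  {p | ∃ y ∈ K, inner ℝ (unitVec p.2) y = inner ℝ (unitVec p.2) p.1}

theorem isClosed_meetSet {K : Set Plane} (hK : IsCompact K) : IsClosed (meetSet K) := by
  have : CompactSpace K := isCompact_iff_compactSpace.1 hK
  have hu := continuous_unitVec
  have hc : IsClosed {p : K × (Plane × ℝ) |
      inner ℝ (unitVec p.2.2) (p.1 : Plane) = inner ℝ (unitVec p.2.2) p.2.1} :=
    isClosed_eq (by fun_prop) (by fun_prop)
  convert isClosedMap_snd_of_compactSpace _ hc using 1
  ext p
  constructor
  · rintro ⟨y, hy, h⟩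
    exact ⟨(⟨y, hy⟩, p), h, rfl⟩
  · rintro ⟨⟨y, q⟩, h, rfl⟩
    exact ⟨y, y.2, h⟩

theorem IsBarrier.image_inner_subset {K B : Set Plane} (h : IsBarrier K B) (α : ℝ) :
    (fun x => inner ℝ (unitVec α) x) '' K ⊆
      (fun x => inner ℝ (unitVec α) x) '' {x ∈ B | (x, α) ∈ meetSet K} := by
  rintro _ ⟨y, hy, rfl⟩
  have h0 : unitVec α ≠ 0 := norm_ne_zero_iff.1 (by rw [norm_unitVec]; exact one_ne_zero)
  have : Fact (Module.finrank ℝ Plane = 1 + 1) := ⟨by simp⟩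
  obtain ⟨z, hzL, hzB⟩ := h (AffineSubspace.mk' y (ℝ ∙ unitVec α)ᗮ)
    (by rw [AffineSubspace.direction_mk']; exact Submodule.finrank_orthogonal_span_singleton h0)
    ⟨y, AffineSubspace.self_mem_mk' _ _, hy⟩
  have hz : inner ℝ (unitVec α) (z - y) = 0 := by
    rw [SetLike.mem_coe, AffineSubspace.mem_mk', vsub_eq_sub,
      Submodule.mem_orthogonal_singleton_iff_inner_right] at hzL
    exact hzL
  rw [inner_sub_right, sub_eq_zero] at hz
  exact ⟨z, ⟨hzB, y, hy, hz.symm⟩, hz⟩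

/-- Stepping back from the apex along -u leaves the cone at once. Hence a point outside K_ζ is not
in `K`, and its directions to `K` are defined. -/
theorem notMem_interior_cone {x u : Plane} (hu : ‖u‖ = 1) {θ : ℝ} (hθ : 0 ≤ cos (θ / 2)) :
    x ∉ interior (cone x u θ) := by
  intro hx
  have hcont : Tendsto (fun t : ℝ => x - t • u) (𝓝[>] 0) (𝓝 x) := by
    have : Continuous fun t : ℝ => x - t • u := by fun_prop
    simpa using (this.tendsto 0).mono_left nhdsWithin_le_nhds
  have hev := (hcont.eventually (mem_interior_iff_mem_nhds.1 hx)).and self_mem_nhdsWithin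
  obtain ⟨t, ht, ht0⟩ := hev.exists
  have ht0' : 0 < t := ht0
  have h1 : ‖x - t • u - x‖ * cos (θ / 2) ≤ inner ℝ u (x - t • u - x) := ht
  rw [sub_sub_cancel_left, inner_neg_right, inner_smul_right, real_inner_self_eq_norm_sq, hu,
    norm_neg, norm_smul, hu] at h1
  have : 0 ≤ ‖t‖ * 1 * cos (θ / 2) := by positivity
  linarith

/-- Lines which pass through a point outside `viewSet K ζ` and meet `K` have a restricted
direction. -/
theorem exists_forall_sin_le_of_notMem_viewSet {K : Set Plane} {ζ : ℝ} (hζ : ζ ∈ Ico 0 π)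
    {x : Plane} (hx : x ∉ viewSet K ζ) :
    ∃ β, ∀ α, (x, α) ∈ meetSet K → sin (ζ / 2) ≤ |cos (α - β)| := by
  obtain ⟨u, hu, hK⟩ := not_not.1 hx
  obtain ⟨γ, hγ⟩ := exists_eq_norm_smul_unitVec u
  rw [hu, one_smul] at hγ
  -- α is the normal of a line whose direction lies within (π - ζ) / 2 of the axis γ, so modulo π it
  -- is equally close to γ + π / 2.
  refine ⟨γ + π / 2, ?_⟩
  rintro α ⟨y, hy, hxy⟩
  have hcos : cos ((π - ζ) / 2) = sin (ζ / 2) := by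
    rw [← cos_pi_div_two_sub]; congr 1; ring
  have hs0 : 0 ≤ sin (ζ / 2) :=
    sin_nonneg_of_nonneg_of_le_pi (by linarith [hζ.1]) (by linarith [hζ.2, pi_pos])
  have hne : y ≠ x := by
    rintro rfl
    exact notMem_interior_cone hu (by rw [hcos]; exact hs0) (hK hy)
  have hcone : ‖y - x‖ * cos ((π - ζ) / 2) ≤ inner ℝ u (y - x) :=
    (interior_subset (hK hy) : y ∈ cone x u (π - ζ))
  have hd0 : 0 < ‖y - x‖ := norm_pos_iff.2 (sub_ne_zero.2 hne)
  obtain ⟨ψ, hψ⟩ := exists_eq_norm_smul_unitVec (y - x)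
  have hperp : inner ℝ (unitVec α) (y - x) = 0 := by
    rw [inner_sub_right, sub_eq_zero]; exact hxy
  rw [hψ, inner_smul_right, inner_unitVec_unitVec] at hperp
  have hc : cos (α - ψ) = 0 := (mul_eq_zero.1 hperp).resolve_left hd0.ne'
  have hle : sin (ζ / 2) ≤ cos (γ - ψ) := by
    have e : inner ℝ u (y - x) = ‖y - x‖ * cos (γ - ψ) := by
      conv_lhs => rw [hψ, hγ, inner_smul_right, inner_unitVec_unitVec]
    rw [e, hcos] at hcone
    exact le_of_mul_le_mul_left hcone hd0
  have hs : |sin (α - ψ)| = 1 := by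
    have := sin_sq_add_cos_sq (α - ψ)
    rw [hc] at this
    exact (sq_eq_sq₀ (abs_nonneg _) zero_le_one).1 (by rw [sq_abs]; linarith)
  have e : cos (α - (γ + π / 2)) = sin (α - ψ) * cos (γ - ψ) := by
    rw [show α - (γ + π / 2) = (α - ψ) - (γ - ψ) - π / 2 by ring, cos_sub_pi_div_two, sin_sub, hc,
      zero_mul, sub_zero]
  rw [e, abs_mul, hs, one_mul]
  exact hle.trans (le_abs_self _)

/-! ### The barrier inequality -/

theorem corollary1 (K B B' : Set Plane) (ζ : ℝ)
    (hK : IsCompact K) (hKconv : Convex ℝ K)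
    (hζ : ζ ∈ Set.Ico 0 Real.pi)
    (hB : IsRectifiable B) (hBK : IsBarrier K B)
    (hB' : IsRectifiable B') (hB'B : B' ⊆ B) (hB'ζ : B' ∩ viewSet K ζ = ∅) :
    perimeter K / 2 + length B' * ENNReal.ofReal (1 - Real.cos (ζ / 2)) ≤ length B := by
  classical
  by_cases hfin : length B = ⊤
  · rw [hfin]; exact le_top
  have hpi := pi_pos
  have hBm := hB.measurableSet
  have hB'm := hB'.measurableSet
  set c := cos (ζ / 2) with hc
  have hc0 : 0 ≤ c := cos_nonneg_of_mem_Icc ⟨by linarith [hζ.1], by linarith [hζ.2]⟩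
  have hc1 : c ≤ 1 := cos_le_one _
  set M : Plane → ENNReal := fun x => if x ∈ B' then ENNReal.ofReal (2 * c) else 2 with hM
  have hMle : ∀ x ∈ B, ∀ θ, ∫⁻ α in Ioc 0 π,
      ENNReal.ofReal |cos (α - θ)| * (meetSet K).indicator 1 (x, α) ≤ M x := by
    intro x hx θ
    by_cases hxB' : x ∈ B'
    · have hxv : x ∉ viewSet K ζ := fun h => hB'ζ.subset ⟨hxB', h⟩
      obtain ⟨β, hβ⟩ := exists_forall_sin_le_of_notMem_viewSet hζ hxv
      -- Half the opening angle π - ζ, so that cos a = sin(ζ/2) and sin a = cos(ζ/2).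
      have h1 := lintegral_abs_cos_sub_indicator_le (a := π / 2 - ζ / 2) (by linarith [hζ.2])
        (by linarith [hζ.1]) β θ
      rw [sin_pi_div_two_sub, cos_pi_div_two_sub] at h1
      simp only [hM, if_pos hxB']
      refine (lintegral_mono fun α => ?_).trans h1
      dsimp only
      gcongr
      by_cases hα : (x, α) ∈ meetSet K
      · rw [indicator_of_mem hα, indicator_of_mem (a := α) (s := {α | sin (ζ / 2) ≤ |cos (α - β)|}) (hβ α hα)]
        exact le_rfl
      · rw [indicator_of_notMem hα]; exact bot_le
    · simp only [hM, if_neg hxB']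
      calc ∫⁻ α in Ioc 0 π, ENNReal.ofReal |cos (α - θ)| * (meetSet K).indicator 1 (x, α)
          ≤ ∫⁻ α in Ioc 0 π, ENNReal.ofReal |cos (α - θ)| := by
            refine lintegral_mono fun α => ?_
            exact mul_le_of_le_one_right bot_le (indicator_le_self' (fun _ _ => bot_le) _)
        _ = ENNReal.ofReal (∫ α in Ioc 0 π, |cos (α - θ)|) :=
            (ofReal_integral_eq_lintegral_ofReal (Continuous.integrableOn_Ioc (by fun_prop))
              (Eventually.of_forall fun _ => abs_nonneg _)).symm
        _ = 2 := by
            rw [← intervalIntegral.integral_of_le hpi.le, integral_abs_cos_sub]; simp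
        _ ≤ 2 := le_rfl
  have hmain : perimeter K ≤ 2 * (ENNReal.ofReal c * length B' + length (B \ B')) := by
    calc perimeter K ≤ ∫⁻ α in Ioc 0 π, volume ((fun x => inner ℝ (unitVec α) x) '' K) :=
          perimeter_le_lintegral_volume_image hK hKconv
      _ ≤ ∫⁻ α in Ioc 0 π,
          volume ((fun x => inner ℝ (unitVec α) x) '' {x ∈ B | (x, α) ∈ meetSet K}) :=
          lintegral_mono fun α => measure_mono (hBK.image_inner_subset α)
      _ ≤ ∫⁻ x in B, M x ∂(Measure.hausdorffMeasure 1) :=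
          lintegral_volume_image_inner_le hBm hfin (isClosed_meetSet hK).measurableSet hMle
            fun ε hε hε1 => hB.hasFlatCover hε hε1
      _ = ∫⁻ x in B', M x ∂(Measure.hausdorffMeasure 1)
          + ∫⁻ x in B \ B', M x ∂(Measure.hausdorffMeasure 1) := by
          rw [← lintegral_union (hBm.diff hB'm) disjoint_sdiff_right, union_sdiff_cancel hB'B]
      _ = 2 * (ENNReal.ofReal c * length B' + length (B \ B')) := by
          rw [setLIntegral_congr_fun hB'm (g := fun _ => ENNReal.ofReal (2 * c))
              (fun x hx => if_pos hx),
            setLIntegral_congr_fun (hBm.diff hB'm) (g := fun _ => 2) (fun x hx => if_neg hx.2),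
            setLIntegral_const, setLIntegral_const, ENNReal.ofReal_mul zero_le_two, mul_add,
            mul_assoc]
          simp [length]
  have hhalf : perimeter K / 2 ≤ ENNReal.ofReal c * length B' + length (B \ B') :=
    ENNReal.div_le_of_le_mul (by rwa [mul_comm])
  have hadd : length B = length B' + length (B \ B') := by
    rw [length, length, length, ← measure_union disjoint_sdiff_right (hBm.diff hB'm),
      union_sdiff_cancel hB'B]
  calc perimeter K / 2 + length B' * ENNReal.ofReal (1 - c)
      ≤ ENNReal.ofReal c * length B' + length (B \ B') + length B' * ENNReal.ofReal (1 - c) := by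
        gcongr
    _ = (ENNReal.ofReal c + ENNReal.ofReal (1 - c)) * length B' + length (B \ B') := by ring
    _ = length B := by
        rw [← ENNReal.ofReal_add hc0 (sub_nonneg.2 hc1), add_sub_cancel, ENNReal.ofReal_one,
          one_mul, hadd]
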